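/- Fix $0<p<1$ and put $N=\frac1{1-p}$. **Trees and graphs.** A heap-ordered $2$-rooted ternary tree $U$ with $n$ true vertices is a plane tree with one bivalent root and $n$ four-valent (true) vertices, labelled increasingly away from the root; each true vertex $v$ has a parent half-edge $e_1(v)$ and ordered child half-edges $e_2(v),e_3(v),e_4(v)$, and the remaining $2n+2$ ends are (amputated) leaves. One root half-edge stands for a factor $\alpha$, the other for $\bar\alpha$; at each true vertex $e_3,e_4$ stand for the same kind of factor as the parent-edge and $e_2$ for the conjugate kind. The $n+1$ ends of kind $\alpha$ are called leaves, the $n+1$ of kind $\bar\alpha$ anti-leaves. A graph $G=(U,w,w')$ with $n$ true vertices consists of such a tree, a bijection $w$ from leaves to anti-leaves (dashed edges), a partition of the true vertices into pairs (wavy edges; so $n$ is even), and for each pair a propagator, i.e. one of the eight terms of $$\langle C^S_{jk}C^{S'}_{j'k'}\rangle=\tfrac{\delta_{SS'}}8\bigl(\delta_{jj'}\delta_{kk'}+\delta_{j,S-j'}\delta_{kk'}+\delta_{jj'}\delta_{k,S-k'}+\delta_{j,S-j'}\delta_{k,S-k'}+\delta_{jk'}\delta_{kj'}+\delta_{j,S-k'}\delta_{kj'}+\delta_{jk'}\delta_{k,S-j'}+\delta_{j,S-k'}\delta_{k,S-j'}\bigr).$$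 **Amplitudes.** A momentum attribution assigns to each true vertex integers $S_v\ge0$ and $0\le j_v,k_v\le S_v$; the half-edges $e_1,\dots,e_4$ of $v$ carry the momenta $j_v,\,S_v-j_v,\,k_v,\,S_v-k_v$, and both root half-edges carry $r\in\mathbb N$. For $r\in\mathbb N$, $$\mathcal A_r(G)=\frac1{N^n}\sum\ \prod_{e\ \mathrm{dashed}}p^{j_e},$$ the sum being over all attributions for which the two ends of every solid and of every dashed edge have equal momenta and the deltas of all propagators hold ($j_e$ is the momentum of the dashed edge $e$). **Degree.** Replace each pair of true vertices by an $8$-valent node, with four corners joining the half-edges whose momenta are identified by the propagator. The closed loops formed by the edges (solid and dashed), the corners and the passage through the root are the faces; let $F$ be their number. Let $E=\zeta\eta$ be the incidence matrix between nodes and faces, where $\eta_{cf}=1$ if the face $f$ passes through the corner $c$ and $0$ otherwise, and $\zeta_{vc}=+1$ for the corners of $v$ with momenta $j_v,S_v-j_v$, $-1$ for those with momenta $k_v,S_v-k_v$, and $0$ for corners not at $v$. Let $R$ be the rank of $E$, $I(\tilde G)=F-R-1$ and $d(G)=n-I(\tilde G)\in\mathbb Z$. **Averaged Sobolev norms.**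 For $\gamma\ge0$ consider the Sobolev norm $S_\gamma(t)=\sum_r r^\gamma|\alpha_r(t)|^2$ of the flow $$i\dot\alpha_j=\sum_{S\ge j}\sum_{k=0}^SC^S_{jk}\bar\alpha_{S-j}\alpha_k\alpha_{S-k}.$$ Its average $\bar S_\gamma(t)=\sum_n\bar s_{\gamma,n}t^n$ is the formal power series obtained by averaging, term by term and by Wick's rule, the tree expansion of the flow over centered Gaussian couplings with the above covariance and centered Gaussian initial data with $\langle\alpha_j(0)\bar\alpha_{j'}(0)\rangle=\delta_{jj'}p^j/N$, $\langle\alpha_j(0)\alpha_{j'}(0)\rangle=0$: $$\bar s_{\gamma,n}=\sum_{r\ge0}\frac{r^\gamma}N\cdot\frac N{n!}\sum_U\sum_{(S,j,k)}\ \prod_v(\pm i)\ \Bigl\langle\prod_vC^{S_v}_{j_vk_v}\Bigr\rangle\Bigl\langle\prod_{\ell\ \mathrm{leaf}}\alpha_{j_\ell}(0)\prod_{\bar\ell\ \text{anti-leaf}}\bar\alpha_{j_{\bar\ell}}(0)\Bigr\rangle,$$ where $U$ runs over the trees with $n$ true vertices, $(S,j,k)$ over the attributions satisfying the constraints of the solid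 edges, the factor of $v$ is $-i$ if its parent-edge is of kind $\alpha$ and $+i$ otherwise, and each average of a product is the Wick sum over pairings of the covariances. Put $\epsilon(U)=\operatorname{Re}\prod_v(\pm i)$. For $\omega\in\mathbb N$, let $$\bar S_{\gamma,\omega}(t)=\sum_n\bar s_{\gamma,\omega,n}t^n,\qquad \bar s_{\gamma,\omega,n}=N^{\omega-\gamma}\sum_{r\ge0}\frac{r^\gamma}N\,\frac{8^{-n/2}}{n!}\sum_{d(G)=\omega}\epsilon(U)\,\mathcal A_r(G)$$ be the rescaled sub-series of the graphs $G=(U,w,w')$ of degree $\omega$. **Proposition.** 1. For every graph $G$, $d(G)\ge0$. 2. For every graph $G$ with $n\ge1$ true vertices, every $r\in\mathbb N$ and every $0<p<1$, the sum defining $\mathcal A_r(G)$ converges and $$\mathcal A_r(G)\le(4n)^{3n/2-1}\,p^{r/(4n)}\,N^{-d(G)}.$$ 3. For every $n\ge0$ there is a constant $K_n$ such that, for every graph $G$ with $n$ true vertices, every $r$ and every $0<p<1$, the sum defining $\mathcal A_r(G)$ converges and $\mathcal A_r(G)\le K_nN^{-d(G)}$. 4. (Existence of the $1/N$ expansion.)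 For every $\gamma\ge0$, all the sums above converge absolutely (the inner sum over attributions for each $U$ and $r$, and the sums over $r$), and, order by order in $t$, $$\bar S_\gamma(t)=N^\gamma\sum_{\omega\ge0}\frac1{N^\omega}\,\bar S_{\gamma,\omega}(t),$$ where at order $t^n$ only $0\le\omega\le n$ contribute; moreover for each $\gamma$ and $n$ the coefficients $\bar s_{\gamma,\omega,n}$ are bounded uniformly in $0<p<1$ and in $\omega$. -/

import Mathlib

noncomputable section

namespace ResonantFlow

/-! ## Heap-ordered 2-rooted ternary plane trees -/

/-- The places where a true vertex can be grafted: the two half-edges of the bivalent root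
(`inl true` on the side of the tree, `inl false` on the side of the anti-tree), and the three ordered
child half-edges `e₂, e₃, e₄` of each true vertex (`inr (u, 0)`, `inr (u, 1)`, `inr (u, 2)`). -/
abbrev Slot (n : ℕ) : Type := Bool ⊕ (Fin n × Fin 3)

/-- A heap-ordered 2-rooted ternary plane tree with `n` true vertices. The true vertices are named by
their heap label; `parent v` is the half-edge to which the parent-edge of `v` is attached. -/
@[ext]
structure HeapTree (n : ℕ) where
  parent : Fin n → Slot n
  parent_injective : Function.Injective parent
  heap : ∀ (v u : Fin n) (i : Fin 3), parent v = Sum.inr (u, i) → u < v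

namespace HeapTree

variable {n : ℕ} (U : HeapTree n)

/-- `true` if the parent-edge of the true vertex `v` stands for a (differentiated) factor `α`,
`false` if it stands for a factor `ᾱ`. The child `e₂` has the opposite kind, the children `e₃`, `e₄`
have the same kind as the vertex. -/
def isAlphaVertex (v : Fin n) : Bool :=
  match _h : U.parent v with
  | Sum.inl b => b
  | Sum.inr (u, i) => if i = 0 then !(isAlphaVertex u) else isAlphaVertex u
termination_by v
decreasing_by all_goals exact U.heap v u i _h

/-- `true` if the edge at this place stands for a factor `α`, `false` for a factor `ᾱ`. -/
def isAlphaSlot : Slot n → Bool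
  | Sum.inl b => b
  | Sum.inr (u, i) => if i = 0 then !(U.isAlphaVertex u) else U.isAlphaVertex u

/-- The leaves: the places without a true vertex that carry a factor `α`. -/
def Leaf : Type := {s : Slot n // s ∉ Set.range U.parent ∧ U.isAlphaSlot s = true}

/-- The anti-leaves: the places without a true vertex that carry a factor `ᾱ`. -/
def AntiLeaf : Type := {s : Slot n // s ∉ Set.range U.parent ∧ U.isAlphaSlot s = false}

instance : Fintype U.Leaf :=
  Fintype.ofInjective (fun l : U.Leaf => l.1) Subtype.val_injective

instance : Fintype U.AntiLeaf :=
  Fintype.ofInjective (fun l : U.AntiLeaf => l.1) Subtype.val_injective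

instance : DecidableEq U.Leaf := Classical.decEq _

instance : DecidableEq U.AntiLeaf := Classical.decEq _

/-- The product of the factors `-i` (vertices coming from the equation for `dα/dt`) and `+i`
(vertices coming from the equation for `dᾱ/dt`). -/
def phase : ℂ := ∏ v : Fin n, if U.isAlphaVertex v then -Complex.I else Complex.I

/-- The sign `ε(U)`. -/
def sign : ℝ := U.phase.re

end HeapTree

instance (n : ℕ) : Fintype (HeapTree n) :=
  Fintype.ofInjective HeapTree.parent fun _ _ h => HeapTree.ext h

/-! ## Wick pairings of the couplings, and the eight propagators -/

/-- A partition of the true vertices into pairs, as a fixed-point free involution. -/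
@[ext]
structure PerfectMatching (n : ℕ) where
  mate : Fin n → Fin n
  mate_mate : ∀ v, mate (mate v) = v
  mate_ne : ∀ v, mate v ≠ v

instance (n : ℕ) : Fintype (PerfectMatching n) :=
  Fintype.ofInjective PerfectMatching.mate fun _ _ h => PerfectMatching.ext h

/-- The pairs of the matching, each one named by its vertex of smaller label. -/
abbrev PerfectMatching.Pair {n : ℕ} (M : PerfectMatching n) : Type := {v : Fin n // v < M.mate v}

/-- The names of the eight products of deltas in the covariance of the couplings. -/
abbrev Propagator : Type := Bool × Bool × Bool

/-- Half-edges at a true vertex are numbered `0, 1, 2, 3` and carry the momenta `j, S - j, k, S - k`.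
A propagator matches each half-edge of the first vertex with one of the second vertex. -/
def Propagator.match : Propagator → Fin 4 → Fin 4
  | (false, a, b) =>
      ![if a then 1 else 0, if a then 0 else 1, if b then 3 else 2, if b then 2 else 3]
  | (true, a, b) =>
      ![if a then 3 else 2, if a then 2 else 3, if b then 1 else 0, if b then 0 else 1]

/-! ## Momenta -/

/-- The three numbers `S`, `j ≤ S`, `k ≤ S` at a true vertex. -/
structure VertexMomenta where
  S : ℕ
  j : ℕ
  k : ℕ
  j_le : j ≤ S
  k_le : k ≤ S

/-- The momenta `j, S - j, k, S - k` of the four half-edges. -/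
def VertexMomenta.mom (q : VertexMomenta) : Fin 4 → ℕ := ![q.j, q.S - q.j, q.k, q.S - q.k]

/-- The product of deltas of a propagator: `S = S'`, and `j`, `k` are identified with the momenta of the
half-edges that are matched with theirs. -/
def Propagator.Holds (g : Propagator) (q q' : VertexMomenta) : Prop :=
  q.S = q'.S ∧ q.mom 0 = q'.mom (g.match 0) ∧ q.mom 2 = q'.mom (g.match 2)

/-- All half-edges: the two at the root and the four at each true vertex. -/
abbrev HalfEdge (n : ℕ) : Type := Bool ⊕ (Fin n × Fin 4)

/-- The half-edge at a given place (half-edge `0` of a true vertex is on its parent-edge). -/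
def Slot.half {n : ℕ} : Slot n → HalfEdge n
  | Sum.inl b => Sum.inl b
  | Sum.inr (u, i) => Sum.inr (u, i.succ)

/-- The momentum of a half-edge; `r` is the momentum at the root. -/
def momentum {n : ℕ} (r : ℕ) (I : Fin n → VertexMomenta) : HalfEdge n → ℕ
  | Sum.inl _ => r
  | Sum.inr (v, e) => (I v).mom e

/-- The two half-edges of every solid edge have the same momentum. -/
def HeapTree.SolidOK {n : ℕ} (U : HeapTree n) (r : ℕ) (I : Fin n → VertexMomenta) : Prop :=
  ∀ v : Fin n, momentum r I (Slot.half (U.parent v)) = momentum r I (Sum.inr (v, 0))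

/-! ## Graphs and their amplitudes -/

/-- A graph `G = (U, w, w')`: a tree, a pairing of its leaves with its anti-leaves (dashed edges), a
pairing of its true vertices (wavy edges) and a propagator on each wavy edge. -/
structure Graph (n : ℕ) where
  tree : HeapTree n
  pairing : tree.Leaf ≃ tree.AntiLeaf
  matching : PerfectMatching n
  prop : matching.Pair → Propagator

instance (n : ℕ) : Fintype (Graph n) :=
  Fintype.ofEquiv
    (Σ U : HeapTree n, (U.Leaf ≃ U.AntiLeaf) × (Σ M : PerfectMatching n, (M.Pair → Propagator)))
    { toFun := fun x => ⟨x.1, x.2.1, x.2.2.1, x.2.2.2⟩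
      invFun := fun G => ⟨G.tree, G.pairing, G.matching, G.prop⟩
      left_inv := fun _ => rfl
      right_inv := fun _ => rfl }

/-- `N = 1 / (1 - p)`. -/
def size (p : ℝ) : ℝ := 1 / (1 - p)

namespace Graph

variable {n : ℕ} (G : Graph n)

/-- All the constraints on the momenta imposed by solid, dashed and wavy edges. -/
def Admissible (r : ℕ) (I : Fin n → VertexMomenta) : Prop :=
  G.tree.SolidOK r I ∧
  (∀ l : G.tree.Leaf,
    momentum r I (Slot.half l.1) = momentum r I (Slot.half (G.pairing l).1)) ∧
  (∀ v : G.matching.Pair, (G.prop v).Holds (I v.1) (I (G.matching.mate v.1)))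

open Classical in
/-- The summand of the amplitude, without the factor `N⁻ⁿ`. -/
def term (p : ℝ) (r : ℕ) (I : Fin n → VertexMomenta) : ℝ :=
  if G.Admissible r I then ∏ l : G.tree.Leaf, p ^ momentum r I (Slot.half l.1) else 0

/-- The amplitude of `G`. -/
def amplitude (p : ℝ) (r : ℕ) : ℝ :=
  1 / size p ^ n * ∑' I : Fin n → VertexMomenta, G.term p r I

/-! ## Stranded representation, faces, degree -/

/-- Elementary pieces of the strands: the passage through the root, the solid and dashed edges, and the
four corners of each 8-valent node (one node for each pair of true vertices). -/
inductive Joined : HalfEdge n → HalfEdge n → Prop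
  | root : Joined (Sum.inl true) (Sum.inl false)
  | solid (v : Fin n) : Joined (Slot.half (G.tree.parent v)) (Sum.inr (v, 0))
  | dashed (l : G.tree.Leaf) : Joined (Slot.half l.1) (Slot.half (G.pairing l).1)
  | corner (v : G.matching.Pair) (e : Fin 4) :
      Joined (Sum.inr (v.1, e)) (Sum.inr (G.matching.mate v.1, (G.prop v).match e))

/-- The faces: the closed loops formed by the strands. -/
def Face : Type := Quot G.Joined

/-- The face passing through a half-edge. -/
def face (h : HalfEdge n) : G.Face := Quot.mk _ h

instance : Finite G.Face := Finite.of_surjective G.face Quot.mk_surjective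

instance : Fintype G.Face := Fintype.ofFinite _

/-- The 8-valent nodes. -/
abbrev Node : Type := G.matching.Pair

/-- The corners: at each node, those with momenta `j, S - j, k, S - k`. -/
abbrev Corner : Type := G.Node × Fin 4

/-- The matrix `ζ`: `+1` at the corners `j, S - j` and `-1` at the corners `k, S - k` of the node. -/
def zeta : Matrix G.Node G.Corner ℚ :=
  fun v c => if c.1 = v then (if c.2 = 0 ∨ c.2 = 1 then 1 else -1) else 0

open Classical in
/-- The matrix `η`: `1` if the face goes through the corner. -/
def eta : Matrix G.Corner G.Face ℚ :=
  fun c f => if G.face (Sum.inr (c.1.1, c.2)) = f then 1 else 0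

/-- The incidence matrix `E = ζ η` between nodes and faces. -/
def incidence : Matrix G.Node G.Face ℚ := G.zeta * G.eta

/-- `I(G̃) = F - R - 1`. -/
def indep : ℤ := (Fintype.card G.Face : ℤ) - (G.incidence.rank : ℤ) - 1

/-- The degree `d(G) = n - I(G̃)`. -/
def degree : ℤ := (n : ℤ) - G.indep

end Graph

/-! ## Averaged Sobolev norms, as formal power series in `t` -/

/-- The covariance `⟨C^S_{jk} C^{S'}_{j'k'}⟩` of the random couplings. -/
def couplingCov (q q' : VertexMomenta) : ℝ :=
  let δ : ℕ → ℕ → ℝ := fun a b => if a = b then 1 else 0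
  let S := q.S
  let j := q.j
  let k := q.k
  let j' := q'.j
  let k' := q'.k
  δ S q'.S / 8 *
    (δ j j' * δ k k' + δ j (S - j') * δ k k' + δ j j' * δ k (S - k') + δ j (S - j') * δ k (S - k')
      + δ j k' * δ k j' + δ j (S - k') * δ k j' + δ j k' * δ k (S - j')
      + δ j (S - k') * δ k (S - j'))

/-- The covariance `⟨α_j(0) ᾱ_{j'}(0)⟩ = δ_{jj'} p^j / N` of the random initial data. -/
def initialCov (p : ℝ) (j j' : ℕ) : ℝ := if j = j' then p ^ j / size p else 0

/-- The Gaussian average of `∏_v C^{S_v}_{j_v k_v}`, by Wick's rule. -/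
def couplingAverage {n : ℕ} (I : Fin n → VertexMomenta) : ℝ :=
  ∑ M : PerfectMatching n, ∏ v : M.Pair, couplingCov (I v.1) (I (M.mate v.1))

/-- The Gaussian average of the product of the factors `α(0)` at the leaves and `ᾱ(0)` at the
anti-leaves, by Wick's rule. -/
def HeapTree.initialAverage {n : ℕ} (U : HeapTree n) (p : ℝ) (r : ℕ)
    (I : Fin n → VertexMomenta) : ℝ :=
  ∑ w : U.Leaf ≃ U.AntiLeaf, ∏ l : U.Leaf,
    initialCov p (momentum r I (Slot.half l.1)) (momentum r I (Slot.half (w l).1))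

open Classical in
/-- The average of the summand, for the momentum attribution `I`, of the amplitude of the 2-rooted
tree `U`. -/
def HeapTree.averagedTerm {n : ℕ} (U : HeapTree n) (p : ℝ) (r : ℕ)
    (I : Fin n → VertexMomenta) : ℂ :=
  if U.SolidOK r I then U.phase * ((couplingAverage I * U.initialAverage p r I : ℝ) : ℂ) else 0

/-- The coefficient of `tⁿ` in the average of `G₂(r, t) = N ᾱ_r(t) α_r(t)`. -/
def averagedG2 (p : ℝ) (n r : ℕ) : ℂ :=
  (size p : ℂ) / (n.factorial : ℂ) *
    ∑ U : HeapTree n, ∑' I : Fin n → VertexMomenta, U.averagedTerm p r I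

/-- The summand `(r ^ γ / N) ⟨G₂(r, t)⟩`, at order `tⁿ`. -/
def averagedSobolevTerm (γ p : ℝ) (n r : ℕ) : ℂ :=
  (((r : ℝ) ^ γ / size p : ℝ) : ℂ) * averagedG2 p n r

/-- The coefficient of `tⁿ` in the averaged Sobolev norm of exponent `γ`. -/
def averagedSobolev (γ p : ℝ) (n : ℕ) : ℂ := ∑' r : ℕ, averagedSobolevTerm γ p n r

open Classical in
/-- The contribution at order `tⁿ` and root momentum `r` of the graphs of degree `ω` to the averaged
Sobolev norm. -/
def degreeTerm (γ p : ℝ) (ω n r : ℕ) : ℝ :=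
  (r : ℝ) ^ γ / size p * (1 / (n.factorial : ℝ) * (8 : ℝ) ^ (-(n : ℝ) / 2) *
    ∑ G : Graph n, if G.degree = (ω : ℤ) then G.tree.sign * G.amplitude p r else 0)

/-- The coefficient of `tⁿ` in the sub-series of the graphs of degree `ω`, rescaled by the factor
`N ^ (γ - ω)` of the `1/N` expansion. -/
def rescaledSubseries (γ p : ℝ) (ω n : ℕ) : ℝ :=
  size p ^ ((ω : ℝ) - γ) * ∑' r : ℕ, degreeTerm γ p ω n r

end ResonantFlow

end

/-! An admissible attribution gives each face one momentum, and these face momenta lie in the kernel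
of the incidence matrix, whose dimension is `indep + 1`. This kernel contains the constant vector,
so the root face can be completed by at most `indep` other faces to a determining system
(`exists_determining_coordinates`). The sum defining the amplitude thus has at most `indep` free
momenta. Conversely, heap order shows that the root and two half-edges per node determine a kernel
vector; there are `n / 2` nodes, so `indep ≤ n` and the degree is nonnegative.

Decay comes from conservation of momentum along the tree: the total leaf momentum `D` bounds every
momentum (`momentum_le_sum_leaf`). With `q = p ^ (1 / (n + 1))`, the weight `p ^ D = q ^ ((n + 1) *
D)` therefore pays for `q ^ r` and one factor `q ^ y` per free momentum `y`. Each geometric series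
is at most `(n + 1) * N` by Bernoulli, which gives the power `N ^ (indep - n)` (`sum_term_le`,
`amplitude_le`).

Wick's rule turns each averaged tree into a finite sum of amplitudes. Half of the decay in `r`
absorbs `r ^ γ` at the cost `N ^ γ`, the other half makes the sum over `r` converge at the cost `N`;
the latter cancels the prefactor `1 / N`. -/

noncomputable section

namespace ResonantFlow

/-! ### Pairs of vertices -/

namespace PerfectMatching

variable {n : ℕ} (M : PerfectMatching n)

theorem lt_mate_or_mate_lt (v : Fin n) : v < M.mate v ∨ M.mate v < v :=
  (lt_or_gt_of_ne (M.mate_ne v)).symm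

theorem two_mul_card_pair : 2 * Fintype.card M.Pair = n := by
  have h : Fintype.card M.Pair = Fintype.card {v : Fin n // ¬ v < M.mate v} := by
    refine Fintype.card_congr
      { toFun := fun v => ⟨M.mate v.1, by rw [M.mate_mate]; exact not_lt.2 v.2.le⟩
        invFun := fun v => ⟨M.mate v.1, by
          rw [M.mate_mate]; exact (M.lt_mate_or_mate_lt v.1).resolve_left v.2⟩
        left_inv := fun v => Subtype.ext (M.mate_mate _)
        right_inv := fun v => Subtype.ext (M.mate_mate _) }
  have h2 := Fintype.card_subtype_compl (fun v : Fin n => v < M.mate v)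
  have h3 := Fintype.card_subtype_le (fun v : Fin n => v < M.mate v)
  rw [Fintype.card_fin] at h2 h3
  change Fintype.card M.Pair ≤ n at h3
  change _ = n - Fintype.card M.Pair at h2
  omega

end PerfectMatching

/-! ### Leaves, momentum conservation and phases of trees -/

namespace HeapTree

variable {n : ℕ} (U : HeapTree n)

theorem isAlphaVertex_eq (v : Fin n) : U.isAlphaVertex v = U.isAlphaSlot (U.parent v) := by
  rw [isAlphaVertex]
  split <;> rename_i h <;> rw [h] <;> rfl

/-- Every slot of kind `α` is a leaf or carries a vertex, unique by injectivity of `parent`.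
Comparing this sum with the one organized by the vertex owning the slot gives both the number of
leaves (`g = 1`) and conservation of momentum (`g` the momentum). -/
theorem sum_alpha_slots (g : Slot n → ℕ) :
    ∑ s, (if U.isAlphaSlot s = true then g s else 0) =
      ∑ l : U.Leaf, g l.1 + ∑ v, if U.isAlphaVertex v = true then g (U.parent v) else 0 := by
  classical
  have hleaf : ∑ l : U.Leaf, g l.1 =
      ∑ s, if s ∉ Set.range U.parent ∧ U.isAlphaSlot s = true then g s else 0 := by
    rw [← Finset.sum_filter]
    exact (Finset.sum_subtype 
      (p := fun s => s ∉ Set.range U.parent ∧ U.isAlphaSlot s = true)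
      (F := inferInstanceAs (Fintype U.Leaf)) _ (by simp) g).symm
  have hpar : (∑ v, if U.isAlphaVertex v = true then g (U.parent v) else 0) =
      ∑ s, if s ∈ Set.range U.parent ∧ U.isAlphaSlot s = true then g s else 0 := by
    have h1 : ∀ v, (if U.isAlphaVertex v = true then g (U.parent v) else 0) =
        (fun s => if U.isAlphaSlot s = true then g s else 0) (U.parent v) := by
      intro v; simp only [U.isAlphaVertex_eq]
    rw [Finset.sum_congr rfl fun v _ => h1 v,
      ← Finset.sum_image (s := Finset.univ) (g := U.parent)
        (f := fun s => if U.isAlphaSlot s = true then g s else 0)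
        fun a _ b _ h => U.parent_injective h,
      ← Finset.sum_filter, ← Finset.sum_filter, Finset.filter_image]
    refine Finset.sum_congr ?_ fun _ _ => rfl
    ext s
    simp only [Finset.mem_image, Finset.mem_filter, Finset.mem_univ, true_and, Set.mem_range]
    constructor
    · rintro ⟨a, h, rfl⟩; exact ⟨⟨a, rfl⟩, h⟩
    · rintro ⟨⟨a, rfl⟩, h⟩; exact ⟨a, h, rfl⟩
  rw [hleaf, hpar, ← Finset.sum_add_distrib]
  refine Finset.sum_congr rfl fun s _ => ?_
  by_cases h : s ∈ Set.range U.parent <;> simp [h]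

theorem sum_alpha_slots_eq_vertices (g : Slot n → ℕ) :
    ∑ s, (if U.isAlphaSlot s = true then g s else 0) =
      g (Sum.inl true) + ∑ u, if U.isAlphaVertex u = true
        then g (Sum.inr (u, 1)) + g (Sum.inr (u, 2)) else g (Sum.inr (u, 0)) := by
  rw [Fintype.sum_sum_type, Fintype.sum_prod_type]
  refine congrArg₂ _ ?_ ?_
  · simp [isAlphaSlot]
  · refine Finset.sum_congr rfl fun u _ => ?_
    cases h : U.isAlphaVertex u <;> simp [isAlphaSlot, Fin.sum_univ_three, h]

theorem card_leaf : Fintype.card U.Leaf = n + 1 := by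
  have h := U.sum_alpha_slots (fun _ => 1)
  rw [sum_alpha_slots_eq_vertices] at h
  -- An `α`-vertex owns two `α`-slots and an `ᾱ`-vertex one; the surplus cancels the slots occupied
  -- by `α`-vertices.
  have h2 : ∀ u, (if U.isAlphaVertex u = true then 1 + 1 else 1) =
      1 + if U.isAlphaVertex u = true then 1 else 0 := by
    intro u; split <;> rfl
  simp only [h2, Finset.sum_add_distrib, Finset.sum_const, Finset.card_univ, Fintype.card_fin,
    smul_eq_mul, mul_one] at h
  omega

/-- Conservation of momentum along the tree: the leaves carry the momentum of the root plus the
momenta entering through the conjugate half-edges. -/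
theorem sum_leaf_momentum {r : ℕ} {I : Fin n → VertexMomenta} (h : U.SolidOK r I) :
    ∑ l : U.Leaf, momentum r I (Slot.half l.1) = r + ∑ v, ((I v).S - (I v).j) := by
  have h1 := U.sum_alpha_slots (fun s => momentum r I (Slot.half s))
  rw [sum_alpha_slots_eq_vertices] at h1
  -- The `α`-children of an `α`-vertex carry `S = (S - j) + j` in total, where `j` enters by the
  -- parent-edge; the only `α`-child of an `ᾱ`-vertex carries `S - j`.
  have h2 : ∀ u, (if U.isAlphaVertex u = true
      then momentum r I (Slot.half (Sum.inr (u, 1))) + momentum r I (Slot.half (Sum.inr (u, 2)))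
      else momentum r I (Slot.half (Sum.inr (u, 0)))) =
      ((I u).S - (I u).j) + if U.isAlphaVertex u = true
        then momentum r I (Slot.half (U.parent u)) else 0 := by
    intro u
    rw [h u]
    have := (I u).j_le
    have := (I u).k_le
    change (if U.isAlphaVertex u = true then (I u).k + ((I u).S - (I u).k) else (I u).S - (I u).j) =
      ((I u).S - (I u).j) + if U.isAlphaVertex u = true then (I u).j else 0
    split <;> omega
  rw [Finset.sum_congr rfl fun u _ => h2 u, Finset.sum_add_distrib] at h1
  change r + _ = _ at h1
  omega

/-- Induction from the root: `j` at `v` is `r` or is at most the `S` of its parent `u`, and passing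
from `j` to `S` costs one new term `S - j`. Since `u < v`, the terms accumulated up to `u` do not
include that of `v`. -/
theorem S_le {r : ℕ} {I : Fin n → VertexMomenta} (h : U.SolidOK r I) (v : Fin n) :
    (I v).S ≤ r + ∑ u ∈ Finset.Iic v, ((I u).S - (I u).j) := by
  induction v using WellFoundedLT.induction with
  | ind v ih =>
  have hv := h v
  have hj := (I v).j_le
  rw [← Finset.Iio_insert, Finset.sum_insert (by simp)]
  change _ = (I v).j at hv
  suffices (I v).j ≤ r + ∑ u ∈ Finset.Iio v, ((I u).S - (I u).j) by omega
  rcases hp : U.parent v with b | ⟨u, i⟩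
  · rw [hp] at hv
    change r = _ at hv
    omega
  · have hu := U.heap v u i hp
    rw [hp] at hv
    change (I u).mom i.succ = _ at hv
    have hm : (I u).mom i.succ ≤ (I u).S := by
      fin_cases i <;> simp [VertexMomenta.mom, (I u).k_le]
    have := ih u hu
    have : ∑ w ∈ Finset.Iic u, ((I w).S - (I w).j) ≤ ∑ w ∈ Finset.Iio v, ((I w).S - (I w).j) :=
      Finset.sum_le_sum_of_subset fun w hw => by
        simp only [Finset.mem_Iic, Finset.mem_Iio] at hw ⊢
        exact lt_of_le_of_lt hw hu
    omega

/-- The bound in `S_le` is a partial sum of the expression for the total leaf momentum, so the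
weight `p ^ D` controls all momenta, not only those of the leaves. -/
theorem momentum_le_sum_leaf {r : ℕ} {I : Fin n → VertexMomenta} (h : U.SolidOK r I)
    (e : HalfEdge n) :
    momentum r I e ≤ ∑ l : U.Leaf, momentum r I (Slot.half l.1) := by
  rw [U.sum_leaf_momentum h]
  rcases e with b | ⟨v, e⟩
  · exact Nat.le_add_right _ _
  · have h1 := U.S_le h v
    have h2 : (I v).mom e ≤ (I v).S := by
      have := (I v).k_le
      have := (I v).j_le
      fin_cases e <;> simp [VertexMomenta.mom] <;> omega
    have h3 : ∑ w ∈ Finset.Iic v, ((I w).S - (I w).j) ≤ ∑ w, ((I w).S - (I w).j) :=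
      Finset.sum_le_sum_of_subset (Finset.subset_univ _)
    change (I v).mom e ≤ _
    omega

/-- With an even number of vertices the phase is real. -/
theorem phase_eq_sign (hn : Even n) : U.phase = (U.sign : ℂ) := by
  have h : ∃ s : ℝ, U.phase = (s : ℂ) := by
    obtain ⟨m, hm⟩ := hn
    have h1 : U.phase = ∏ v : Fin n, (((if U.isAlphaVertex v then -1 else 1 : ℝ) : ℂ) * Complex.I) := by
      refine Finset.prod_congr rfl fun v _ => ?_
      split <;> simp
    refine ⟨(∏ v : Fin n, (if U.isAlphaVertex v then -1 else 1 : ℝ)) * (-1) ^ m, ?_⟩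
    rw [h1, Finset.prod_mul_distrib, Finset.prod_const, Finset.card_univ, Fintype.card_fin,
      show Complex.I ^ n = (-1) ^ m by rw [hm, ← two_mul, pow_mul, Complex.I_sq]]
    push_cast
    rfl
  obtain ⟨s, hs⟩ := h
  rw [sign, hs, Complex.ofReal_re]

theorem abs_sign_le : |U.sign| ≤ 1 := by
  refine (Complex.abs_re_le_norm _).trans ?_
  rw [phase, norm_prod]
  refine Finset.prod_le_one (fun _ _ => norm_nonneg _) fun v _ => ?_
  split <;> simp

end HeapTree

/-! ### Propagators and determining coordinates -/

/-- The deltas concern only `j` and `k`; the complementary half-edges follow from `S = S'`, because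
`match` respects the pairs `{0, 1}` and `{2, 3}`. -/
theorem Propagator.Holds.mom_eq {g : Propagator} {q q' : VertexMomenta} (h : g.Holds q q')
    (e : Fin 4) : q.mom e = q'.mom (g.match e) := by
  obtain ⟨hS, h0, h2⟩ := h
  have := q.j_le
  have := q.k_le
  have := q'.j_le
  have := q'.k_le
  obtain ⟨a, b, c⟩ := g
  cases a <;> cases b <;> cases c <;> fin_cases e <;>
    simp [Propagator.match, VertexMomenta.mom] at h0 h2 ⊢ <;> omega

theorem couplingCov_eq (q q' : VertexMomenta) [∀ g : Propagator, Decidable (g.Holds q q')] :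
    couplingCov q q' = 1 / 8 * ∑ g : Propagator, if g.Holds q q' then 1 else 0 := by
  have key : ∀ (a b : Prop) [Decidable a] [Decidable b],
      ((if a then 1 else 0 : ℝ) * if b then 1 else 0) = if a ∧ b then 1 else 0 := by
    intro a b _ _; by_cases a <;> by_cases b <;> simp_all
  by_cases hS : q.S = q'.S
  · simp only [Fintype.sum_prod_type, Fintype.sum_bool, Propagator.Holds, couplingCov, key]
    simp [hS, Propagator.match, VertexMomenta.mom]
    ring
  · simp [couplingCov, Propagator.Holds, hS]

/-- A subspace `V` of a coordinate space with a vector that does not vanish at `i₀` has a system of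
at most `dim V` determining coordinates that contains `i₀`. -/
theorem exists_determining_coordinates {K ι : Type*} [Field K] [Finite ι]
    (V : Submodule K (ι → K)) (i₀ : ι) (hV : ∃ x ∈ V, x i₀ ≠ 0) :
    ∃ B : Finset ι, i₀ ∉ B ∧ B.card + 1 ≤ Module.finrank K V ∧
      ∀ x ∈ V, x i₀ = 0 → (∀ i ∈ B, x i = 0) → x = 0 := by
  classical
  have := Fintype.ofFinite ι
  let φ : ι → Module.Dual K V := fun i => (LinearMap.proj i).comp V.subtype
  have h0 : LinearIndepOn K φ {i₀} := by
    rw [linearIndepOn_singleton_iff]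
    obtain ⟨x, hx, hx0⟩ := hV
    exact fun h => hx0 (LinearMap.congr_fun h ⟨x, hx⟩)
  -- Extend the nonzero form at `i₀` to a maximal independent family among the coordinate forms on
  -- `V`; its size is at most the dimension of the dual of `V`.
  obtain ⟨b, -, hb0, hspan, hli⟩ := exists_linearIndepOn_extension h0 (Set.subset_univ {i₀})
  have hi₀ : i₀ ∈ b.toFinset := by simpa using hb0
  refine ⟨b.toFinset.erase i₀, Finset.notMem_erase _ _, ?_, ?_⟩
  · rw [Finset.card_erase_add_one hi₀, Set.toFinset_card, ← Subspace.dual_finrank_eq]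
    exact hli.fintype_card_le_finrank
  · intro x hx h0 hB
    have hker : Submodule.span K (φ '' b) ≤
        LinearMap.ker (LinearMap.applyₗ (R := K) (M₂ := K) (⟨x, hx⟩ : V)) := by
      rw [Submodule.span_le]
      rintro _ ⟨i, hi, rfl⟩
      change x i = 0
      by_cases h : i = i₀
      · rw [h, h0]
      · exact hB i (by simp [h, hi])
    funext i
    exact hker (hspan ⟨i, trivial, rfl⟩)

/-! ### Cycle space, degree and face momenta -/

namespace Graph

variable {n : ℕ} (G : Graph n)

theorem even_vertices {n : ℕ} (G : Graph n) : Even n :=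
  ⟨Fintype.card G.Node, by rw [← two_mul]; exact G.matching.two_mul_card_pair.symm⟩

/-- The momenta of the faces conserved at every node. -/
def cycleSpace : Submodule ℚ (G.Face → ℚ) := LinearMap.ker G.incidence.mulVecLin

theorem finrank_cycleSpace : (Module.finrank ℚ G.cycleSpace : ℤ) = G.indep + 1 := by
  have h := LinearMap.finrank_range_add_finrank_ker G.incidence.mulVecLin
  rw [Module.finrank_fintype_fun_eq_card] at h
  change G.incidence.rank + Module.finrank ℚ G.cycleSpace = _ at h
  rw [indep]
  omega

theorem incidence_mulVec (x : G.Face → ℚ) (v : G.Node) :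
    G.incidence.mulVec x v = x (G.face (Sum.inr (v.1, 0))) + x (G.face (Sum.inr (v.1, 1))) -
      x (G.face (Sum.inr (v.1, 2))) - x (G.face (Sum.inr (v.1, 3))) := by
  have hη : ∀ c, G.eta.mulVec x c = x (G.face (Sum.inr (c.1.1, c.2))) := by
    classical
    intro c
    simp [Matrix.mulVec, dotProduct, eta]
  rw [incidence, ← Matrix.mulVec_mulVec, Matrix.mulVec, dotProduct, Fintype.sum_prod_type,
    Finset.sum_eq_single v]
  · simp [Fin.sum_univ_four, zeta, hη]
    ring
  · intro w _ hw
    simp [zeta, hw]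
  · simp

theorem mem_cycleSpace {x : G.Face → ℚ} : x ∈ G.cycleSpace ↔ ∀ v : G.Node,
    x (G.face (Sum.inr (v.1, 0))) + x (G.face (Sum.inr (v.1, 1))) =
      x (G.face (Sum.inr (v.1, 2))) + x (G.face (Sum.inr (v.1, 3))) := by
  rw [cycleSpace, LinearMap.mem_ker, Matrix.mulVecLin_apply, funext_iff]
  refine forall_congr' fun v => ?_
  rw [incidence_mulVec, Pi.zero_apply, sub_sub, sub_eq_zero]

theorem one_mem_cycleSpace : (1 : G.Face → ℚ) ∈ G.cycleSpace := by
  simp [mem_cycleSpace]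

/-- The face through the root. -/
def rootFace : G.Face := G.face (Sum.inl true)

/-- Conserved face momenta are determined by the root and two half-edges at each node. -/
theorem eq_zero_of_mem_cycleSpace {x : G.Face → ℚ} (hx : x ∈ G.cycleSpace)
    (hroot : x G.rootFace = 0)
    (hnode : ∀ v : G.Node, x (G.face (Sum.inr (v.1, 1))) = 0 ∧ x (G.face (Sum.inr (v.1, 2))) = 0) :
    x = 0 := by
  rw [mem_cycleSpace] at hx
  have hv : ∀ v : Fin n, ∀ e, x (G.face (Sum.inr (v, e))) = 0 := by
    intro v
    induction v using WellFoundedLT.induction with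
    | ind v ih =>
    -- For the first vertex of a pair, half-edge `0` is known from the parent, `1` and `2` by
    -- hypothesis, and `3` by conservation. For the second one, every half-edge shares a face with
    -- one of its earlier mate.
    rcases G.matching.lt_mate_or_mate_lt v with hlt | hlt
    · have h0 : x (G.face (Sum.inr (v, 0))) = 0 := by
        have hs : G.face (Slot.half (G.tree.parent v)) = G.face (Sum.inr (v, 0)) :=
          Quot.sound (Joined.solid v)
        rw [← hs]
        rcases hp : G.tree.parent v with b | ⟨u, i⟩
        · cases b
          · rw [← hroot]
            exact congrArg x (Quot.sound Joined.root).symm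
          · exact hroot
        · exact ih u (G.tree.heap v u i hp) _
      have h12 := hnode ⟨v, hlt⟩
      have h3 := hx ⟨v, hlt⟩
      rw [h0, h12.1, h12.2] at h3
      intro e
      fin_cases e
      · exact h0
      · exact h12.1
      · exact h12.2
      · simpa using h3.symm
    · intro e
      let w : G.matching.Pair := ⟨G.matching.mate v, by rwa [G.matching.mate_mate]⟩
      obtain ⟨e', he'⟩ : ∃ e', (G.prop w).match e' = e := by
        obtain ⟨a, b, c⟩ := G.prop w
        revert e
        cases a <;> cases b <;> cases c <;> decide
      have hc := Quot.sound (Joined.corner (G := G) w e')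
      rw [he', show G.matching.mate w.1 = v from G.matching.mate_mate v] at hc
      rw [face, ← hc]
      exact ih _ hlt e'
  funext f
  obtain ⟨h, rfl⟩ := Quot.mk_surjective f
  rcases h with b | ⟨v, e⟩
  · cases b
    · exact (congrArg x (Quot.sound Joined.root).symm).trans hroot
    · exact hroot
  · exact hv v e

/-- Evaluation at the root face and at two half-edges of each of the `n / 2` nodes is injective on
the cycle space, whose dimension is thus at most `n + 1`. -/
theorem indep_le : G.indep ≤ n := by
  let L : G.cycleSpace →ₗ[ℚ] (Option (G.Node × Bool) → ℚ) :=
    LinearMap.pi fun o => (LinearMap.proj (match o with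
      | none => G.rootFace
      | some (v, b) => G.face (Sum.inr (v.1, if b then 1 else 2)))).comp G.cycleSpace.subtype
  have hL : Function.Injective L := by
    rw [← LinearMap.ker_eq_bot, LinearMap.ker_eq_bot']
    intro x hx
    refine Subtype.ext (G.eq_zero_of_mem_cycleSpace x.2 (congrFun hx none) fun v => ⟨?_, ?_⟩)
    · exact congrFun hx (some (v, true))
    · exact congrFun hx (some (v, false))
  have h := LinearMap.finrank_le_finrank_of_injective hL
  rw [Module.finrank_fintype_fun_eq_card, Fintype.card_option, Fintype.card_prod,
    Fintype.card_bool, mul_comm, G.matching.two_mul_card_pair] at h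
  have := G.finrank_cycleSpace
  omega

theorem degree_nonneg : 0 ≤ G.degree := by
  have := G.indep_le
  rw [degree]
  omega

theorem indep_nonneg : 0 ≤ G.indep := by
  have h1 : 0 < Module.finrank ℚ G.cycleSpace := by
    rw [Module.finrank_pos_iff, Submodule.nontrivial_iff_ne_bot, Submodule.ne_bot_iff]
    exact ⟨1, G.one_mem_cycleSpace, fun h => one_ne_zero (congrFun h G.rootFace)⟩
  have := G.finrank_cycleSpace
  omega

theorem degree_le : G.degree ≤ n := by
  have := G.indep_nonneg
  rw [degree]
  omega

variable {G}

theorem Admissible.momentum_eq {r : ℕ} {I : Fin n → VertexMomenta} (h : G.Admissible r I)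
    {a b : HalfEdge n} (hab : G.Joined a b) : momentum r I a = momentum r I b := by
  cases hab with
  | root => rfl
  | solid v => exact h.1 v
  | dashed l => exact h.2.1 l
  | corner v e => exact (h.2.2 v).mom_eq e

/-- The momenta of the faces of an admissible attribution. -/
def Admissible.faceMomentum {r : ℕ} {I : Fin n → VertexMomenta} (h : G.Admissible r I) :
    G.Face → ℕ :=
  Quot.lift (momentum r I) fun _ _ hab => h.momentum_eq hab

theorem Admissible.faceMomentum_mem {r : ℕ} {I : Fin n → VertexMomenta} (h : G.Admissible r I) :
    (fun f => (h.faceMomentum f : ℚ)) ∈ G.cycleSpace := by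
  rw [mem_cycleSpace]
  intro v
  have hj := (I v.1).j_le
  have hk := (I v.1).k_le
  have : (I v.1).j + ((I v.1).S - (I v.1).j) = (I v.1).k + ((I v.1).S - (I v.1).k) := by omega
  exact_mod_cast this

theorem Admissible.eq_of_faceMomentum_eq {r : ℕ} {I J : Fin n → VertexMomenta}
    (hI : G.Admissible r I) (hJ : G.Admissible r J) (h : hI.faceMomentum = hJ.faceMomentum) :
    I = J := by
  funext v
  have hm : ∀ e, (I v).mom e = (J v).mom e := fun e => congrFun h (G.face (Sum.inr (v, e)))
  have h0 : (I v).j = (J v).j := hm 0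
  have h1 : (I v).S - (I v).j = (J v).S - (J v).j := hm 1
  have h2 : (I v).k = (J v).k := hm 2
  have := (I v).j_le
  have := (J v).j_le
  have hS : (I v).S = (J v).S := by omega
  revert hS h0 h2
  generalize I v = a
  generalize J v = b
  cases a
  cases b
  rintro rfl rfl rfl
  rfl

end Graph

/-! ### Geometric sums -/

theorem size_pos {p : ℝ} (hp1 : p < 1) : 0 < size p :=
  one_div_pos.2 (sub_pos.2 hp1)

theorem one_le_size {p : ℝ} (hp0 : 0 < p) (hp1 : p < 1) : 1 ≤ size p := by
  rw [size, le_div_iff₀ (sub_pos.2 hp1)]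
  linarith

/-- A finite set of exponents lies in a box, on which the sum factorizes into truncated geometric
series. -/
theorem sum_prod_pow_le {ι : Type*} [Fintype ι] {q : ℝ} (h0 : 0 ≤ q) (h1 : q < 1)
    (t : Finset (ι → ℕ)) : ∑ y ∈ t, ∏ i, q ^ y i ≤ ((1 - q)⁻¹) ^ Fintype.card ι := by
  classical
  let M := t.sup fun y => ∑ i, y i
  have ht : t ⊆ Fintype.piFinset fun _ : ι => Finset.range (M + 1) := by
    intro y hy
    rw [Fintype.mem_piFinset]
    intro i
    have h2 : y i ≤ ∑ i, y i := Finset.single_le_sum (fun _ _ => Nat.zero_le _) (Finset.mem_univ i)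
    have h3 : ∑ i, y i ≤ M := Finset.le_sup (f := fun y : ι → ℕ => ∑ i, y i) hy
    rw [Finset.mem_range]
    omega
  calc ∑ y ∈ t, ∏ i, q ^ y i
      ≤ ∑ y ∈ Fintype.piFinset fun _ : ι => Finset.range (M + 1), ∏ i, q ^ y i :=
        Finset.sum_le_sum_of_subset_of_nonneg ht fun _ _ _ =>
          Finset.prod_nonneg fun _ _ => pow_nonneg h0 _
    _ = ∏ _i : ι, ∑ k ∈ Finset.range (M + 1), q ^ k :=
        (Finset.prod_univ_sum (fun _ => Finset.range (M + 1)) fun _ k => q ^ k).symm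
    _ ≤ ∏ _i : ι, (1 - q)⁻¹ := by
        refine Finset.prod_le_prod (fun _ _ => Finset.sum_nonneg fun _ _ => pow_nonneg h0 _)
          fun _ _ => ?_
        rw [← tsum_geometric_of_lt_one h0 h1]
        exact (summable_geometric_of_lt_one h0 h1).sum_le_tsum _ fun _ _ => pow_nonneg h0 _
    _ = _ := by simp

/-- Bernoulli: `p = (1 + (q - 1)) ^ m ≥ 1 - m * (1 - q)`, so `1 - p ≤ m * (1 - q)`. -/
theorem inv_one_sub_root_le {p q : ℝ} {m : ℕ} (hq : 0 ≤ q) (hq1 : q < 1) (hp1 : p < 1)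
    (hpq : q ^ m = p) : (1 - q)⁻¹ ≤ m * size p := by
  have h := one_add_mul_le_pow (a := q - 1) (by linarith) m
  rw [add_sub_cancel, hpq] at h
  rw [size, mul_one_div, le_div_iff₀ (sub_pos.2 hp1), inv_mul_le_iff₀ (sub_pos.2 hq1)]
  linarith

theorem root_pow {p : ℝ} (hp : 0 ≤ p) {m : ℕ} (hm : m ≠ 0) : (p ^ (1 / (m : ℝ))) ^ m = p := by
  rw [one_div]
  exact Real.rpow_inv_natCast_pow hp hm

theorem root_lt_one {p : ℝ} (hp : 0 ≤ p) (hp1 : p < 1) {m : ℕ} (hm : m ≠ 0) :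
    p ^ (1 / (m : ℝ)) < 1 :=
  Real.rpow_lt_one hp hp1 (by positivity)

/-! ### Bounds on amplitudes -/

namespace Graph

variable {n : ℕ} (G : Graph n)

theorem term_nonneg {p : ℝ} (hp : 0 ≤ p) (r : ℕ) (I : Fin n → VertexMomenta) :
    0 ≤ G.term p r I := by
  rw [term]
  split
  · exact Finset.prod_nonneg fun _ _ => pow_nonneg hp _
  · exact le_rfl

/-- The bound is uniform over finite sets of attributions, so it yields both summability and the
estimate of the full sum. -/
theorem sum_term_le {p : ℝ} (hp0 : 0 < p) (hp1 : p < 1) (r : ℕ)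
    (s : Finset (Fin n → VertexMomenta)) :
    ∑ I ∈ s, G.term p r I ≤ (p ^ (1 / ((n + 1 : ℕ) : ℝ))) ^ r *
      (((n + 1 : ℕ) : ℝ) * size p) ^ G.indep.toNat := by
  classical
  set q : ℝ := p ^ (1 / ((n + 1 : ℕ) : ℝ)) with hq
  have hq0 : 0 < q := Real.rpow_pos_of_pos hp0 _
  have hq1 : q < 1 := root_lt_one hp0.le hp1 n.succ_ne_zero
  have hqp : q ^ (n + 1) = p := root_pow hp0.le n.succ_ne_zero
  obtain ⟨B, hB0, hBcard, hB⟩ := exists_determining_coordinates G.cycleSpace G.rootFace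
    ⟨1, G.one_mem_cycleSpace, one_ne_zero⟩
  have hdim := G.finrank_cycleSpace
  have hle := G.indep_le
  -- Each face of `B` is read at an arbitrary half-edge on it, so that `y` makes sense without
  -- admissibility; on admissible attributions it is the face momentum.
  let y : (Fin n → VertexMomenta) → B → ℕ := fun I b => momentum r I (Quot.out b.1)
  have hy : ∀ {I} (h : G.Admissible r I) (b : B), y I b = h.faceMomentum b.1 := by
    intro I h b
    conv_rhs => rw [← Quot.out_eq b.1]
    rfl
  have hinj : Set.InjOn y (s.filter (G.Admissible r)) := by
    intro I hI J hJ hIJ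
    have hI : G.Admissible r I := (Finset.mem_filter.1 hI).2
    have hJ : G.Admissible r J := (Finset.mem_filter.1 hJ).2
    refine hI.eq_of_faceMomentum_eq hJ (funext fun f => ?_)
    have h := hB _ (G.cycleSpace.sub_mem hI.faceMomentum_mem hJ.faceMomentum_mem)
      (sub_self (r : ℚ)) fun b hb => by
        have := congrFun hIJ ⟨b, hb⟩
        rw [hy hI, hy hJ] at this
        simp [this]
    have hf := congrFun h f
    simpa [sub_eq_zero] using hf
  have hterm : ∀ I, G.Admissible r I → G.term p r I ≤ q ^ r * ∏ b, q ^ y I b := by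
    intro I h
    rw [term, if_pos h, Finset.prod_pow_eq_pow_sum, Finset.prod_pow_eq_pow_sum, ← pow_add, ← hqp,
      ← pow_mul]
    refine pow_le_pow_of_le_one hq0.le hq1.le ?_
    set D := ∑ l : G.tree.Leaf, momentum r I (Slot.half l.1)
    have h1 : r ≤ D := G.tree.momentum_le_sum_leaf h.1 (Sum.inl true)
    have h2 : ∑ b, y I b ≤ Fintype.card B * D :=
      (Finset.sum_le_card_nsmul _ _ D fun b _ => G.tree.momentum_le_sum_leaf h.1 _).trans_eq
        (by rw [Finset.card_univ, smul_eq_mul])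
    rw [Fintype.card_coe] at h2
    -- The root and the faces of `B` are at most `indep + 1 ≤ n + 1` momenta, each at most `D`: this
    -- fixes the root `1 / (n + 1)` in `q`.
    have h3 : (B.card + 1) * D ≤ (n + 1) * D := Nat.mul_le_mul_right _ (by omega)
    linarith
  calc ∑ I ∈ s, G.term p r I = ∑ I ∈ s.filter (G.Admissible r), G.term p r I := by
        rw [Finset.sum_filter]
        refine Finset.sum_congr rfl fun I _ => ?_
        by_cases h : G.Admissible r I <;> simp [h, term]
    _ ≤ ∑ I ∈ s.filter (G.Admissible r), q ^ r * ∏ b, q ^ y I b :=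
        Finset.sum_le_sum fun I hI => hterm I (Finset.mem_filter.1 hI).2
    _ = q ^ r * ∑ z ∈ (s.filter (G.Admissible r)).image y, ∏ b, q ^ z b := by
        rw [Finset.sum_image hinj, Finset.mul_sum]
    _ ≤ q ^ r * ((1 - q)⁻¹) ^ Fintype.card B :=
        mul_le_mul_of_nonneg_left (sum_prod_pow_le hq0.le hq1 _) (pow_nonneg hq0.le _)
    _ ≤ q ^ r * (((n + 1 : ℕ) : ℝ) * size p) ^ Fintype.card B := by
        refine mul_le_mul_of_nonneg_left (pow_le_pow_left₀ ?_ ?_ _) (pow_nonneg hq0.le _)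
        · exact inv_nonneg.2 (sub_nonneg.2 hq1.le)
        · exact inv_one_sub_root_le hq0.le hq1 hp1 hqp
    _ ≤ q ^ r * (((n + 1 : ℕ) : ℝ) * size p) ^ G.indep.toNat := by
        refine mul_le_mul_of_nonneg_left (pow_le_pow_right₀ ?_ ?_) (pow_nonneg hq0.le _)
        · exact one_le_mul_of_one_le_of_one_le (by simp) (one_le_size hp0 hp1)
        · rw [Fintype.card_coe]
          omega

theorem summable_term {p : ℝ} (hp0 : 0 < p) (hp1 : p < 1) (r : ℕ) : Summable (G.term p r) :=
  summable_of_sum_le (G.term_nonneg hp0.le r) (G.sum_term_le hp0 hp1 r)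

theorem amplitude_nonneg {p : ℝ} (hp0 : 0 < p) (hp1 : p < 1) (r : ℕ) : 0 ≤ G.amplitude p r :=
  mul_nonneg (one_div_nonneg.2 (pow_nonneg (size_pos hp1).le _))
    (tsum_nonneg (G.term_nonneg hp0.le r))

theorem amplitude_le {p : ℝ} (hp0 : 0 < p) (hp1 : p < 1) (r : ℕ) :
    G.amplitude p r ≤ ((n + 1 : ℕ) : ℝ) ^ n * (p ^ (1 / ((n + 1 : ℕ) : ℝ))) ^ r *
      size p ^ (-G.degree) := by
  have hN := size_pos hp1
  have hle := G.indep_le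
  have hI := G.indep_nonneg
  have hpow : (1 / size p ^ n) * size p ^ G.indep.toNat = size p ^ (-G.degree) := by
    rw [one_div, ← zpow_natCast, ← zpow_natCast, ← zpow_neg, ← zpow_add₀ hN.ne', degree]
    congr 1
    omega
  calc G.amplitude p r ≤ 1 / size p ^ n * ((p ^ (1 / ((n + 1 : ℕ) : ℝ))) ^ r *
        (((n + 1 : ℕ) : ℝ) * size p) ^ G.indep.toNat) :=
        mul_le_mul_of_nonneg_left
          (Real.tsum_le_of_sum_le (G.term_nonneg hp0.le r) (G.sum_term_le hp0 hp1 r))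
          (by positivity)
    _ = ((n + 1 : ℕ) : ℝ) ^ G.indep.toNat * (p ^ (1 / ((n + 1 : ℕ) : ℝ))) ^ r *
        size p ^ (-G.degree) := by
        rw [mul_pow, ← hpow]
        ring
    _ ≤ _ := by
        have : ((n + 1 : ℕ) : ℝ) ^ G.indep.toNat ≤ ((n + 1 : ℕ) : ℝ) ^ n :=
          pow_le_pow_right₀ (by simp) (by omega)
        gcongr

theorem amplitude_le_of_pos (hn : 0 < n) {p : ℝ} (hp0 : 0 < p) (hp1 : p < 1) (r : ℕ) :
    G.amplitude p r ≤ (4 * (n : ℝ)) ^ (3 * (n : ℝ) / 2 - 1) * p ^ ((r : ℝ) / (4 * (n : ℝ))) *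
      size p ^ (-G.degree) := by
  have hN := size_pos hp1
  -- Pairing makes `n` even, hence `n ≥ 2`, which is exactly what `n ≤ 3 * n / 2 - 1` requires
  -- below.
  have h2 : 2 ≤ n := by
    obtain ⟨m, hm⟩ := G.even_vertices
    omega
  have h2' : (2 : ℝ) ≤ n := by exact_mod_cast h2
  refine (G.amplitude_le hp0 hp1 r).trans ?_
  have ha : ((n + 1 : ℕ) : ℝ) ^ n ≤ (4 * (n : ℝ)) ^ (3 * (n : ℝ) / 2 - 1) := by
    calc ((n + 1 : ℕ) : ℝ) ^ n ≤ (4 * (n : ℝ)) ^ n :=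
          pow_le_pow_left₀ (by positivity) (by push_cast; linarith) _
      _ = (4 * (n : ℝ)) ^ (n : ℝ) := (Real.rpow_natCast _ _).symm
      _ ≤ _ := Real.rpow_le_rpow_of_exponent_le (by linarith) (by linarith)
  have hb : (p ^ (1 / ((n + 1 : ℕ) : ℝ))) ^ r ≤ p ^ ((r : ℝ) / (4 * (n : ℝ))) := by
    rw [← Real.rpow_natCast, ← Real.rpow_mul hp0.le, one_div_mul_eq_div]
    refine Real.rpow_le_rpow_of_exponent_ge hp0 hp1.le ?_
    refine div_le_div_of_nonneg_left (by positivity) (by positivity) ?_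
    push_cast
    linarith
  gcongr

end Graph

/-! ### Wick expansion into graphs -/

/-- The pairings and propagators that turn a tree into a graph. -/
abbrev HeapTree.Decoration {n : ℕ} (U : HeapTree n) : Type :=
  (U.Leaf ≃ U.AntiLeaf) × (Σ M : PerfectMatching n, (M.Pair → Propagator))

/-- The graph obtained from a tree by choosing pairings and propagators. -/
def HeapTree.decorate {n : ℕ} (U : HeapTree n) (x : U.Decoration) : Graph n :=
  ⟨U, x.1, x.2.1, x.2.2⟩

theorem Graph.sum_eq_sum_decorate {n : ℕ} {A : Type*} [AddCommMonoid A] (F : Graph n → A) :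
    ∑ G, F G = ∑ U : HeapTree n, ∑ x : U.Decoration, F (U.decorate x) := by
  rw [← Fintype.sum_sigma']
  exact Fintype.sum_equiv
    { toFun := fun G => ⟨G.tree, G.pairing, G.matching, G.prop⟩
      invFun := fun y => y.1.decorate y.2
      left_inv := fun _ => rfl
      right_inv := fun _ => rfl } _ _ fun _ => rfl

theorem prod_ite_one_zero {ι R : Type*} [Fintype ι] [CommSemiring R] (P : ι → Prop)
    [∀ i, Decidable (P i)] [Decidable (∀ i, P i)] :
    (∏ i, if P i then (1 : R) else 0) = if ∀ i, P i then 1 else 0 := by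
  split_ifs with h
  · exact Finset.prod_eq_one fun i _ => if_pos (h i)
  · obtain ⟨i, hi⟩ := not_forall.1 h
    exact Finset.prod_eq_zero (Finset.mem_univ i) (if_neg hi)

theorem PerfectMatching.one_div_eight_pow {n : ℕ} (M : PerfectMatching n) :
    (1 / 8 : ℝ) ^ Fintype.card M.Pair = (8 : ℝ) ^ (-(n : ℝ) / 2) := by
  have h : (n : ℝ) = 2 * Fintype.card M.Pair := by exact_mod_cast M.two_mul_card_pair.symm
  rw [h, neg_div, mul_div_cancel_left₀ _ (two_ne_zero), Real.rpow_neg (by norm_num),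
    Real.rpow_natCast, one_div, inv_pow]

open Classical in
theorem couplingAverage_eq {n : ℕ} (I : Fin n → VertexMomenta) :
    couplingAverage I = (8 : ℝ) ^ (-(n : ℝ) / 2) *
      ∑ y : (Σ M : PerfectMatching n, (M.Pair → Propagator)),
        if ∀ v : y.1.Pair, (y.2 v).Holds (I v.1) (I (y.1.mate v.1)) then 1 else 0 := by
  rw [Fintype.sum_sigma, couplingAverage, Finset.mul_sum]
  refine Finset.sum_congr rfl fun M _ => ?_
  simp only [couplingCov_eq]
  rw [Finset.prod_mul_distrib, Finset.prod_const, Finset.card_univ, M.one_div_eight_pow,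
    Finset.prod_univ_sum, Fintype.piFinset_univ]
  congr 1
  exact Finset.sum_congr rfl fun g _ => prod_ite_one_zero _

open Classical in
-- The `n + 1` leaves give one factor `1 / N` more than the amplitude contains; the prefactor `N` of
-- `averagedG2` compensates for it.
theorem HeapTree.initialAverage_eq {n : ℕ} (U : HeapTree n) (p : ℝ) (r : ℕ)
    (I : Fin n → VertexMomenta) :
    U.initialAverage p r I = 1 / size p ^ (n + 1) * ∑ w : U.Leaf ≃ U.AntiLeaf,
      if ∀ l, momentum r I (Slot.half l.1) = momentum r I (Slot.half (w l).1)
        then ∏ l : U.Leaf, p ^ momentum r I (Slot.half l.1) else 0 := by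
  rw [HeapTree.initialAverage, Finset.mul_sum]
  refine Finset.sum_congr rfl fun w _ => ?_
  have h : ∀ l : U.Leaf, initialCov p (momentum r I (Slot.half l.1))
      (momentum r I (Slot.half (w l).1)) = 1 / size p * (p ^ momentum r I (Slot.half l.1) *
        if momentum r I (Slot.half l.1) = momentum r I (Slot.half (w l).1) then 1 else 0) := by
    intro l
    rw [initialCov]
    split_ifs <;> ring
  rw [Finset.prod_congr rfl fun l _ => h l, Finset.prod_mul_distrib, Finset.prod_mul_distrib,
    Finset.prod_const, Finset.card_univ, U.card_leaf, prod_ite_one_zero, one_div_pow]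
  split_ifs <;> simp

theorem HeapTree.averagedTerm_eq {n : ℕ} (U : HeapTree n) (p : ℝ) (r : ℕ)
    (I : Fin n → VertexMomenta) :
    U.averagedTerm p r I = U.phase * (((8 : ℝ) ^ (-(n : ℝ) / 2) * (1 / size p ^ (n + 1)) *
      ∑ x : U.Decoration, (U.decorate x).term p r I : ℝ) : ℂ) := by
  classical
  by_cases hU : U.SolidOK r I
  · rw [averagedTerm, if_pos hU, couplingAverage_eq, U.initialAverage_eq, mul_mul_mul_comm,
      mul_comm (∑ y : (Σ M : PerfectMatching n, (M.Pair → Propagator)), _),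
      Fintype.sum_mul_sum, ← Fintype.sum_prod_type']
    congr 4
    funext x
    simp only [Graph.term, Graph.Admissible, decorate, hU, true_and]
    rw [mul_ite, mul_one, mul_zero, ← ite_and]
    exact ite_congr (propext and_comm) (fun _ => rfl) fun _ => rfl
  · rw [averagedTerm, if_neg hU, Finset.sum_eq_zero]
    · simp
    · exact fun x _ => if_neg fun h => hU h.1

theorem HeapTree.hasSum_averagedTerm {n : ℕ} (U : HeapTree n) {p : ℝ} (hp0 : 0 < p) (hp1 : p < 1)
    (r : ℕ) :
    HasSum (U.averagedTerm p r) (U.phase * (((8 : ℝ) ^ (-(n : ℝ) / 2) * (1 / size p) *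
      ∑ x : U.Decoration, (U.decorate x).amplitude p r : ℝ) : ℂ)) := by
  have h1 : HasSum (fun I => ∑ x : U.Decoration, (U.decorate x).term p r I)
      (∑ x : U.Decoration, ∑' I, (U.decorate x).term p r I) :=
    hasSum_sum fun x _ => ((U.decorate x).summable_term hp0 hp1 r).hasSum
  have h2 := (Complex.hasSum_ofReal.2
    (h1.mul_left ((8 : ℝ) ^ (-(n : ℝ) / 2) * (1 / size p ^ (n + 1))))).mul_left U.phase
  have h3 : U.averagedTerm p r = _ := funext fun I => U.averagedTerm_eq p r I
  rw [h3]
  have h4 : (8 : ℝ) ^ (-(n : ℝ) / 2) * (1 / size p) *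
      ∑ x : U.Decoration, (U.decorate x).amplitude p r =
      (8 : ℝ) ^ (-(n : ℝ) / 2) * (1 / size p ^ (n + 1)) *
        ∑ x : U.Decoration, ∑' I, (U.decorate x).term p r I := by
    simp only [Graph.amplitude]
    rw [← Finset.mul_sum, pow_succ]
    ring
  rw [h4]
  exact h2

theorem averagedG2_eq {p : ℝ} (hp0 : 0 < p) (hp1 : p < 1) (n r : ℕ) :
    averagedG2 p n r = ((1 / (n.factorial : ℝ) * (8 : ℝ) ^ (-(n : ℝ) / 2) *
      ∑ G : Graph n, G.tree.sign * G.amplitude p r : ℝ) : ℂ) := by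
  have hN := (size_pos hp1).ne'
  have hU : ∀ U : HeapTree n, ∑' I, U.averagedTerm p r I =
      (((8 : ℝ) ^ (-(n : ℝ) / 2) * (1 / size p) *
        ∑ x : U.Decoration, U.sign * (U.decorate x).amplitude p r : ℝ) : ℂ) := by
    intro U
    rw [(U.hasSum_averagedTerm hp0 hp1 r).tsum_eq]
    -- The phase is known to be real only for even `n`. Any decoration forces this parity, and
    -- without one both sides vanish.
    rcases isEmpty_or_nonempty U.Decoration with h | ⟨⟨x⟩⟩
    · simp
    · rw [U.phase_eq_sign (U.decorate x).even_vertices, ← Complex.ofReal_mul, ← Finset.mul_sum]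
      congr 1
      ring
  rw [averagedG2, Finset.sum_congr rfl fun U _ => hU U, Graph.sum_eq_sum_decorate, ← Complex.ofReal_sum,
    ← Finset.mul_sum]
  push_cast
  have : (size p : ℂ) ≠ 0 := by exact_mod_cast hN
  field_simp
  rfl

/-- Since `0 ≤ degree ≤ n`, each graph is counted for exactly one `ω` in the range. -/
theorem averagedSobolevTerm_eq {p : ℝ} (hp0 : 0 < p) (hp1 : p < 1) (γ : ℝ) (n r : ℕ) :
    averagedSobolevTerm γ p n r =
      ((∑ ω ∈ Finset.range (n + 1), degreeTerm γ p ω n r : ℝ) : ℂ) := by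
  rw [averagedSobolevTerm, averagedG2_eq hp0 hp1, ← Complex.ofReal_mul]
  congr 1
  simp only [degreeTerm]
  rw [← Finset.mul_sum, ← Finset.mul_sum, Finset.sum_comm]
  congr 2
  refine Finset.sum_congr rfl fun G _ => ?_
  have h0 := G.degree_nonneg
  have h1 := G.degree_le
  rw [Finset.sum_eq_single_of_mem G.degree.toNat (Finset.mem_range.2 (by omega)), if_pos (by omega)]
  intro ω _ hω
  rw [if_neg (by omega)]

/-! ### Sums over the root momentum -/

/-- A power against a geometric decay, uniformly in the ratio. -/
theorem rpow_mul_pow_le {γ : ℝ} {s : ℝ} (hγ : 0 ≤ γ) (h0 : 0 ≤ s) (h1 : s < 1) (r : ℕ) :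
    (r : ℝ) ^ γ * s ^ r ≤ (⌈γ⌉₊.factorial * Real.exp 1) * ((1 - s)⁻¹) ^ γ := by
  have hs : 0 < 1 - s := sub_pos.2 h1
  set y : ℝ := r * (1 - s) with hy
  have hy0 : 0 ≤ y := by positivity
  have hr : (r : ℝ) ^ γ = y ^ γ * ((1 - s)⁻¹) ^ γ := by
    rw [← Real.mul_rpow hy0 (inv_nonneg.2 hs.le), hy, mul_inv_cancel_right₀ hs.ne']
  have hpow : s ^ r ≤ Real.exp (-y) := by
    have : s ≤ Real.exp (-(1 - s)) := by
      have := Real.add_one_le_exp (-(1 - s))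
      linarith
    calc s ^ r ≤ Real.exp (-(1 - s)) ^ r := pow_le_pow_left₀ h0 this r
      _ = Real.exp (-y) := by rw [← Real.exp_nat_mul, hy]; ring_nf
  -- Passing to `1 + y ≥ 1` allows the exponent to be rounded up to an integer even when `y < 1`;
  -- the shift costs the factor `exp 1`.
  have hyγ : y ^ γ ≤ ⌈γ⌉₊.factorial * Real.exp (1 + y) := by
    have h2 := Real.pow_div_factorial_le_exp (1 + y) (by positivity) ⌈γ⌉₊
    rw [div_le_iff₀' (by positivity)] at h2
    calc y ^ γ ≤ (1 + y) ^ γ := Real.rpow_le_rpow hy0 (by linarith) hγ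
      _ ≤ (1 + y) ^ (⌈γ⌉₊ : ℝ) :=
        Real.rpow_le_rpow_of_exponent_le (by linarith) (Nat.le_ceil γ)
      _ = (1 + y) ^ ⌈γ⌉₊ := Real.rpow_natCast _ _
      _ ≤ _ := h2
  calc (r : ℝ) ^ γ * s ^ r = y ^ γ * s ^ r * ((1 - s)⁻¹) ^ γ := by rw [hr]; ring
    _ ≤ (⌈γ⌉₊.factorial * Real.exp (1 + y)) * Real.exp (-y) * ((1 - s)⁻¹) ^ γ := by gcongr
    _ = _ := by
      rw [mul_assoc _ (Real.exp (1 + y)), ← Real.exp_add]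
      ring_nf

/-- The constant in the bound on the sum over the root momentum. -/
def sobolevConst (γ : ℝ) (n : ℕ) : ℝ := ∑ _G : Graph n, ((n + 1 : ℕ) : ℝ) ^ n *
  (⌈γ⌉₊.factorial * Real.exp 1 * ((2 * (n + 1) : ℕ) : ℝ) ^ γ)

theorem sobolevConst_nonneg (γ : ℝ) (n : ℕ) : 0 ≤ sobolevConst γ n :=
  Finset.sum_nonneg fun _ _ => by positivity

/-- The decay `q ^ r` of the amplitude equals `s ^ r * s ^ r` with `s = p ^ (1 / (2 * (n + 1)))`:
one factor absorbs `r ^ γ`, the other remains for the sum over `r`. -/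
theorem abs_degreeTerm_le {γ p : ℝ} (hγ : 0 ≤ γ) (hp0 : 0 < p) (hp1 : p < 1) (ω n r : ℕ) :
    |degreeTerm γ p ω n r| ≤ sobolevConst γ n * size p ^ (γ - ω - 1) *
      (p ^ (1 / ((2 * (n + 1) : ℕ) : ℝ))) ^ r := by
  classical
  have hm : 2 * (n + 1) ≠ 0 := by omega
  set s : ℝ := p ^ (1 / ((2 * (n + 1) : ℕ) : ℝ)) with hs
  have hs0 : 0 < s := Real.rpow_pos_of_pos hp0 _
  have hs1 : s < 1 := root_lt_one hp0.le hp1 hm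
  have hsp : s ^ (2 * (n + 1)) = p := root_pow hp0.le hm
  have hN := size_pos hp1
  have hq : p ^ (1 / ((n + 1 : ℕ) : ℝ)) = s ^ 2 := by
    rw [hs, ← Real.rpow_natCast, ← Real.rpow_mul hp0.le]
    congr 1
    push_cast
    field_simp
  have hr : (r : ℝ) ^ γ * s ^ r ≤
      ⌈γ⌉₊.factorial * Real.exp 1 * ((2 * (n + 1) : ℕ) : ℝ) ^ γ * size p ^ γ := by
    refine (rpow_mul_pow_le hγ hs0.le hs1 r).trans ?_
    rw [mul_assoc (_ * _), ← Real.mul_rpow (by positivity) hN.le]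
    refine mul_le_mul_of_nonneg_left (Real.rpow_le_rpow ?_ ?_ hγ) (by positivity)
    · exact inv_nonneg.2 (sub_nonneg.2 hs1.le)
    · exact inv_one_sub_root_le hs0.le hs1 hp1 hsp
  have hpre : |1 / (n.factorial : ℝ) * (8 : ℝ) ^ (-(n : ℝ) / 2)| ≤ 1 := by
    rw [abs_of_nonneg (by positivity)]
    refine mul_le_one₀ ?_ (by positivity) ?_
    · rw [div_le_one (by positivity)]
      exact_mod_cast n.factorial_pos
    · exact Real.rpow_le_one_of_one_le_of_nonpos (by norm_num)
        (by rw [neg_div]; exact neg_nonpos.2 (by positivity))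
  have hexp : size p ^ (γ - ω - 1) = size p ^ γ / size p * size p ^ (-(ω : ℤ)) := by
    rw [Real.rpow_sub hN, Real.rpow_sub hN, Real.rpow_one, Real.rpow_natCast, zpow_neg,
      zpow_natCast]
    ring
  have hG : ∀ G : Graph n, (r : ℝ) ^ γ / size p *
      |if G.degree = (ω : ℤ) then G.tree.sign * G.amplitude p r else 0| ≤
      ((n + 1 : ℕ) : ℝ) ^ n * (⌈γ⌉₊.factorial * Real.exp 1 * ((2 * (n + 1) : ℕ) : ℝ) ^ γ) *
        size p ^ (γ - ω - 1) * s ^ r := by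
    intro G
    split_ifs with h
    · have hA := G.amplitude_le hp0 hp1 r
      rw [h, hq] at hA
      have hA0 := G.amplitude_nonneg hp0 hp1 r
      have hsA : |G.tree.sign * G.amplitude p r| ≤ G.amplitude p r := by
        rw [abs_mul, abs_of_nonneg hA0]
        exact mul_le_of_le_one_left hA0 G.tree.abs_sign_le
      calc (r : ℝ) ^ γ / size p * |G.tree.sign * G.amplitude p r|
          ≤ (r : ℝ) ^ γ / size p * (((n + 1 : ℕ) : ℝ) ^ n * (s ^ 2) ^ r * size p ^ (-(ω : ℤ))) :=
            mul_le_mul_of_nonneg_left (hsA.trans hA) (by positivity)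
        _ = ((r : ℝ) ^ γ * s ^ r) *
            (((n + 1 : ℕ) : ℝ) ^ n * s ^ r * size p ^ (-(ω : ℤ)) / size p) := by
            rw [← pow_mul, two_mul, pow_add]
            ring
        _ ≤ (⌈γ⌉₊.factorial * Real.exp 1 * ((2 * (n + 1) : ℕ) : ℝ) ^ γ * size p ^ γ) *
            (((n + 1 : ℕ) : ℝ) ^ n * s ^ r * size p ^ (-(ω : ℤ)) / size p) :=
            mul_le_mul_of_nonneg_right hr (by positivity)
        _ = _ := by
            rw [hexp]
            ring
    · rw [abs_zero, mul_zero]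
      positivity
  calc |degreeTerm γ p ω n r|
      = |1 / (n.factorial : ℝ) * (8 : ℝ) ^ (-(n : ℝ) / 2)| * ((r : ℝ) ^ γ / size p *
        |∑ G : Graph n, if G.degree = (ω : ℤ) then G.tree.sign * G.amplitude p r else 0|) := by
        rw [degreeTerm, abs_mul, abs_mul, abs_of_nonneg (by positivity : 0 ≤ (r : ℝ) ^ γ / size p)]
        ring
    _ ≤ (r : ℝ) ^ γ / size p *
        |∑ G : Graph n, if G.degree = (ω : ℤ) then G.tree.sign * G.amplitude p r else 0| :=
        mul_le_of_le_one_left (by positivity) hpre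
    _ ≤ (r : ℝ) ^ γ / size p *
        ∑ G : Graph n, |if G.degree = (ω : ℤ) then G.tree.sign * G.amplitude p r else 0| :=
        mul_le_mul_of_nonneg_left (Finset.abs_sum_le_sum_abs _ _) (by positivity)
    _ ≤ _ := by
        rw [Finset.mul_sum, sobolevConst, Finset.sum_mul, Finset.sum_mul]
        exact Finset.sum_le_sum fun G _ => hG G

theorem summable_degreeTerm {γ p : ℝ} (hγ : 0 ≤ γ) (hp0 : 0 < p) (hp1 : p < 1) (ω n : ℕ) :
    Summable (degreeTerm γ p ω n) := by
  refine Summable.of_norm_bounded (Summable.mul_left _ (summable_geometric_of_lt_one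
    (Real.rpow_nonneg hp0.le _) (root_lt_one hp0.le hp1 (m := 2 * (n + 1)) (by omega))))
    fun r => abs_degreeTerm_le hγ hp0 hp1 ω n r

/-- The geometric sum over `r` contributes one factor `N`, and all powers of `N` cancel: `(ω - γ) +
(γ - ω - 1) + 1 = 0`. -/
theorem abs_rescaledSubseries_le {γ p : ℝ} (hγ : 0 ≤ γ) (hp0 : 0 < p) (hp1 : p < 1) (ω n : ℕ) :
    |rescaledSubseries γ p ω n| ≤ sobolevConst γ n * (2 * (n + 1) : ℕ) := by
  have hm : 2 * (n + 1) ≠ 0 := by omega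
  have hN := size_pos hp1
  have hs0 : 0 ≤ p ^ (1 / ((2 * (n + 1) : ℕ) : ℝ)) := Real.rpow_nonneg hp0.le _
  have hs1 := root_lt_one hp0.le hp1 hm
  have hgeom := (hasSum_geometric_of_lt_one hs0 hs1).mul_left
    (sobolevConst γ n * size p ^ (γ - ω - 1))
  have hC := sobolevConst_nonneg γ n
  calc |rescaledSubseries γ p ω n|
      = size p ^ ((ω : ℝ) - γ) * |∑' r, degreeTerm γ p ω n r| := by
        rw [rescaledSubseries, abs_mul, abs_of_pos (Real.rpow_pos_of_pos hN _)]
    _ ≤ size p ^ ((ω : ℝ) - γ) * (sobolevConst γ n * size p ^ (γ - ω - 1) *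
        ((2 * (n + 1) : ℕ) * size p)) := by
        refine mul_le_mul_of_nonneg_left ?_ (by positivity)
        refine (tsum_of_norm_bounded (f := degreeTerm γ p ω n) hgeom fun r => abs_degreeTerm_le hγ hp0 hp1 ω n r).trans ?_
        exact mul_le_mul_of_nonneg_left
          (inv_one_sub_root_le hs0 hs1 hp1 (root_pow hp0.le hm)) (by positivity)
    _ = sobolevConst γ n * (2 * (n + 1) : ℕ) *
        (size p ^ ((ω : ℝ) - γ) * size p ^ (γ - ω - 1) * size p) := by ring
    _ = _ := by
        rw [← Real.rpow_add hN, ← Real.rpow_add_one hN.ne',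
          show (ω : ℝ) - γ + (γ - ω - 1) + 1 = 0 by ring, Real.rpow_zero, mul_one]

theorem size_mul_rescaledSubseries {p : ℝ} (hp1 : p < 1) (γ : ℝ) (ω n : ℕ) :
    size p ^ γ * (1 / size p ^ ω * rescaledSubseries γ p ω n) = ∑' r, degreeTerm γ p ω n r := by
  have hN := size_pos hp1
  have h1 := (Real.rpow_pos_of_pos hN γ).ne'
  rw [rescaledSubseries, Real.rpow_sub hN, Real.rpow_natCast]
  field_simp

end ResonantFlow

end

theorem mainTheorem3 :
    (∀ (n : ℕ) (G : ResonantFlow.Graph n), 0 ≤ G.degree) ∧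
    (∀ (n : ℕ), 0 < n → ∀ (G : ResonantFlow.Graph n) (r : ℕ) (p : ℝ), 0 < p → p < 1 →
      Summable (G.term p r) ∧
      G.amplitude p r ≤
        (4 * (n : ℝ)) ^ (3 * (n : ℝ) / 2 - 1) * p ^ ((r : ℝ) / (4 * (n : ℝ))) *
          ResonantFlow.size p ^ (-G.degree)) ∧
    (∀ n : ℕ, ∃ K : ℝ, ∀ (G : ResonantFlow.Graph n) (r : ℕ) (p : ℝ), 0 < p → p < 1 →
      Summable (G.term p r) ∧ G.amplitude p r ≤ K * ResonantFlow.size p ^ (-G.degree)) ∧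
    (∀ (γ : ℝ), 0 ≤ γ → ∀ n : ℕ,
      (∀ p : ℝ, 0 < p → p < 1 →
        (∀ (U : ResonantFlow.HeapTree n) (r : ℕ), Summable (U.averagedTerm p r)) ∧
        Summable (ResonantFlow.averagedSobolevTerm γ p n) ∧
        (∀ ω : ℕ, Summable (ResonantFlow.degreeTerm γ p ω n)) ∧
        ResonantFlow.averagedSobolev γ p n =
          ((ResonantFlow.size p ^ γ * ∑ ω ∈ Finset.range (n + 1),
            1 / ResonantFlow.size p ^ ω * ResonantFlow.rescaledSubseries γ p ω n : ℝ) : ℂ)) ∧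
      (∃ K : ℝ, ∀ (p : ℝ) (ω : ℕ), 0 < p → p < 1 →
        |ResonantFlow.rescaledSubseries γ p ω n| ≤ K)) := by
  refine ⟨fun n G => G.degree_nonneg, fun n hn G r p hp0 hp1 => ⟨G.summable_term hp0 hp1 r,
    G.amplitude_le_of_pos hn hp0 hp1 r⟩, fun n => ⟨((n + 1 : ℕ) : ℝ) ^ n, fun G r p hp0 hp1 =>
    ⟨G.summable_term hp0 hp1 r, ?_⟩⟩, fun γ hγ n => ⟨fun p hp0 hp1 => ?_, ?_⟩⟩
  -- The constant `(n + 1) ^ n` is that of `amplitude_le`, with the decay in `r` bounded by `1`; it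
  -- also covers `n = 0`.
  · have hN := ResonantFlow.size_pos hp1
    refine (G.amplitude_le hp0 hp1 r).trans (mul_le_mul_of_nonneg_right ?_ (by positivity))
    refine mul_le_of_le_one_right (by positivity) (pow_le_one₀ (Real.rpow_nonneg hp0.le _) ?_)
    exact (ResonantFlow.root_lt_one hp0.le hp1 n.succ_ne_zero).le
  · have hdeg := fun ω => ResonantFlow.summable_degreeTerm hγ hp0 hp1 ω n
    have hsum : HasSum (ResonantFlow.averagedSobolevTerm γ p n)
        ((∑ ω ∈ Finset.range (n + 1), ∑' r, ResonantFlow.degreeTerm γ p ω n r : ℝ) : ℂ) := by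
      rw [funext fun r => ResonantFlow.averagedSobolevTerm_eq hp0 hp1 γ n r]
      exact Complex.hasSum_ofReal.2 (hasSum_sum fun ω _ => (hdeg ω).hasSum)
    refine ⟨fun U r => (U.hasSum_averagedTerm hp0 hp1 r).summable, hsum.summable, hdeg, ?_⟩
    rw [ResonantFlow.averagedSobolev, hsum.tsum_eq, Finset.mul_sum,
      Finset.sum_congr rfl fun ω _ => ResonantFlow.size_mul_rescaledSubseries hp1 γ ω n]
  · exact ⟨_, fun p ω hp0 hp1 => ResonantFlow.abs_rescaledSubseries_le hγ hp0 hp1 ω n⟩
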